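/- **Setting (continuous time).** Let $\mathcal X\subset\mathbb R^n$, $\mathcal U\subset\mathbb R^m$, $f:\mathcal X\times\mathcal U\to\mathbb R^n$, let $r:\mathcal X\times\mathcal U\to\mathbb R$ be measurable and bounded, $\tau>0$, $p\ge 0$, and let $X_F\subset\mathcal X$ be closed in $\mathcal X$. A trajectory from $x\in\mathcal X$ under $u:\mathcal X\to\mathcal U$ is a continuous $y:[0,\infty)\to\mathcal X$ with $y(0)=x$ and $\dot y(t)=f(y(t),u(y(t)))$ for every $t\ge0$ (right derivative). Let $\mathfrak U$ be the set of feedback controllers: measurable $u:\mathcal X\to\mathcal U$ whose trajectories are well defined for all time, that is, from every $x\in\mathcal X$ there is exactly one trajectory, denoted $\phi_x^u$. The set $X_F$ is absorbing: for $u\in\mathfrak U$, a trajectory $\phi^u_x$ starting in $x\in X_F$ stays in $X_F$. A controller $u$ is safe for $x$ if $\phi_x^u(t)\notin X_F$ for all $t\ge0$. The viability kernel $X_V$ is the set of $x\in\mathcal X$ for which some $u\in\mathfrak U$ is safe; $X_U=\mathcal X\setminus X_V$; and $\mathfrak U_{\rm safe}$ is the set of $u\in\mathfrak U$ that are safe for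 all $x\in X_V$. Put $$G(x,u)=\int_0^\infty e^{-t/\tau}\,r\big(\phi_x^u(t),u(\phi_x^u(t))\big)\,dt,\qquad \rho(x,u)=e^{-t_f/\tau},$$ where $t_f\in[0,\infty]$ is the first time at which $\phi_x^u$ is in $X_F$ ($\rho=0$ if $t_f=\infty$), and $$V_p(x)=\sup_{u\in\mathfrak U}\big(G(x,u)-p\,\rho(x,u)\big)\ (x\in\mathcal X),\qquad V(x)=\sup_{u\in\mathfrak U_{\rm safe}}G(x,u)\ (x\in X_V).$$ A controller $u\in\mathfrak U$ is an optimal controller of $V_p$ if $G(x,u)-p\rho(x,u)=V_p(x)$ for all $x\in\mathcal X$; assume that one exists. Let $\mu$ be a probability distribution with support in $X_V$. $V_p$ is a *safe value function* if each of its optimal controllers $u$ lies in $\mathfrak U_{\rm safe}$ and maximizes $\mathbb E_{x\sim\mu}[G(x,u)]$ over $\mathfrak U_{\rm safe}$. Let $$\alpha_{\inf}=\sup_{X_U}V_p,\qquad \alpha_{\sup}=\inf_{X_V}V$$ in $[-\infty,\infty]$; the *zeroth-order condition* is $\alpha_{\inf}<\alpha_{\sup}$. A *control barrier function* of a closed set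 $C$ on $D\supseteq C$ is a continuously differentiable $h:D\to\mathbb R$ such that $C=\{x\in D: h(x)\ge0\}$ and such that there is an extended class $\mathcal K_\infty$ function $\kappa$ (continuous, strictly increasing, $\kappa(0)=0$, $\kappa(s)\to\pm\infty$ as $s\to\pm\infty$) with $$\sup_{a\in\mathcal U}\ \nabla h(x)\cdot f(x,a)\ \ge\ -\kappa(h(x))\qquad\text{for all }x\in D.$$ **Proposition.** Let $V_p$ be a safe value function such that the zeroth-order condition holds. Assume that $f$ is continuous on $X_V\times\mathcal U$, that $V_{p|X_V}$ is continuously differentiable, that $X_V$ is compact, and that $\nabla V_{p|X_V}(x)\ne0$ for all $x$ in the boundary of $X_V$ in $\mathcal X$. Then, for all real $\alpha\in(\alpha_{\inf},\alpha_{\sup}]$, the function $h=V_{p|X_V}-\alpha$ is a control barrier function of $X_V$ (with $D=X_V$). -/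

import Mathlib

open Set Filter Topology MeasureTheory

noncomputable section

/-- Data of a continuous-time control problem with failure set: state set `X ⊆ ℝⁿ`, control set
`U ⊆ ℝᵐ`, dynamics `f`, reward `r`, discount rate `τ > 0` and a failure set `XF` that is closed
in `X`. Only the values of `f` and `r` on `X × U` matter. -/
structure ControlProblem (n m : ℕ) where
  X : Set (EuclideanSpace ℝ (Fin n))
  U : Set (EuclideanSpace ℝ (Fin m))
  f : EuclideanSpace ℝ (Fin n) → EuclideanSpace ℝ (Fin m) → EuclideanSpace ℝ (Fin n)
  r : EuclideanSpace ℝ (Fin n) → EuclideanSpace ℝ (Fin m) → ℝ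
  τ : ℝ
  XF : Set (EuclideanSpace ℝ (Fin n))
  τ_pos : 0 < τ
  r_measurable : Measurable (fun q : X × U => r q.1 q.2)
  r_bounded : ∃ M : ℝ, ∀ x ∈ X, ∀ a ∈ U, |r x a| ≤ M
  XF_closed : ∃ K : Set (EuclideanSpace ℝ (Fin n)), IsClosed K ∧ XF = X ∩ K

namespace ControlProblem

variable {n m : ℕ} (S : ControlProblem n m)

/-- `y` (on times `t ≥ 0`) is a trajectory from `x` under the feedback `u`: it is continuous,
stays in `X` and satisfies `ẏ(t) = f(y(t), u(y(t)))` at every `t ≥ 0`. As `u` may jump, and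
motion may stop when the failure set is hit, `ẏ` is the right derivative (which, for classical
solutions, is the derivative). -/
def IsTrajectory (u : EuclideanSpace ℝ (Fin n) → EuclideanSpace ℝ (Fin m))
    (x : EuclideanSpace ℝ (Fin n)) (y : ℝ → EuclideanSpace ℝ (Fin n)) : Prop :=
  y 0 = x ∧ ContinuousOn y (Ici 0) ∧
    ∀ t : ℝ, 0 ≤ t → y t ∈ S.X ∧ HasDerivWithinAt y (S.f (y t) (u (y t))) (Ici t) t

/-- The feedback controllers: measurable maps `X → U` whose trajectories are well defined for
all time, i.e. from every state of `X` there is exactly one trajectory. -/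
def controllers : Set (EuclideanSpace ℝ (Fin n) → EuclideanSpace ℝ (Fin m)) :=
  {u | MapsTo u S.X S.U ∧ Measurable (fun x : S.X => u x) ∧
    ∀ x ∈ S.X, ∃ y, S.IsTrajectory u x y ∧ ∀ z, S.IsTrajectory u x z → EqOn z y (Ici 0)}

open Classical in
/-- The trajectory from `x` under `u` (constant if there is none). -/
def flow (u : EuclideanSpace ℝ (Fin n) → EuclideanSpace ℝ (Fin m))
    (x : EuclideanSpace ℝ (Fin n)) : ℝ → EuclideanSpace ℝ (Fin n) :=
  if h : ∃ y, S.IsTrajectory u x y then h.choose else fun _ => x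

/-- The failure set is absorbing: trajectories that start in it remain in it. -/
def FailureAbsorbing : Prop :=
  ∀ u ∈ S.controllers, ∀ x ∈ S.XF, ∀ t : ℝ, 0 ≤ t → S.flow u x t ∈ S.XF

/-- `u` is safe for the point `x`: the trajectory from `x` never fails. -/
def SafeFor (u : EuclideanSpace ℝ (Fin n) → EuclideanSpace ℝ (Fin m))
    (x : EuclideanSpace ℝ (Fin n)) : Prop :=
  ∀ t : ℝ, 0 ≤ t → S.flow u x t ∉ S.XF

/-- The viability kernel. -/
def XV : Set (EuclideanSpace ℝ (Fin n)) :=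
  {x | x ∈ S.X ∧ ∃ u ∈ S.controllers, S.SafeFor u x}

/-- The unviability kernel. -/
def XU : Set (EuclideanSpace ℝ (Fin n)) := S.X \ S.XV

/-- The safe controllers: safe for every point of the viability kernel. -/
def safeControllers : Set (EuclideanSpace ℝ (Fin n) → EuclideanSpace ℝ (Fin m)) :=
  {u | u ∈ S.controllers ∧ ∀ x ∈ S.XV, S.SafeFor u x}

/-- The discounted return `G(x, u)`. -/
def ret (x : EuclideanSpace ℝ (Fin n))
    (u : EuclideanSpace ℝ (Fin n) → EuclideanSpace ℝ (Fin m)) : ℝ :=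
  ∫ t in Ioi (0 : ℝ), Real.exp (-t / S.τ) * S.r (S.flow u x t) (u (S.flow u x t))

/-- The time to failure (meaningful if the trajectory fails). -/
def failureTime (x : EuclideanSpace ℝ (Fin n))
    (u : EuclideanSpace ℝ (Fin n) → EuclideanSpace ℝ (Fin m)) : ℝ :=
  sInf {t : ℝ | 0 ≤ t ∧ S.flow u x t ∈ S.XF}

open Classical in
/-- The discounted risk `ρ(x, u)`: `exp (-t_f / τ)` with `t_f` the time to failure, `0` if the
trajectory never fails. -/
def risk (x : EuclideanSpace ℝ (Fin n))
    (u : EuclideanSpace ℝ (Fin n) → EuclideanSpace ℝ (Fin m)) : ℝ :=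
  if S.SafeFor u x then 0 else Real.exp (-S.failureTime x u / S.τ)

/-- The penalized value function `V_p`. -/
def Vp (p : ℝ) (x : EuclideanSpace ℝ (Fin n)) : ℝ :=
  sSup ((fun u => S.ret x u - p * S.risk x u) '' S.controllers)

/-- The constrained value function `V` (to be used on the viability kernel). -/
def V (x : EuclideanSpace ℝ (Fin n)) : ℝ :=
  sSup ((fun u => S.ret x u) '' S.safeControllers)

/-- `u` is an optimal controller of `V_p`: it attains the supremum at every state. -/
def IsOptimal (p : ℝ) (u : EuclideanSpace ℝ (Fin n) → EuclideanSpace ℝ (Fin m)) : Prop :=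
  u ∈ S.controllers ∧ ∀ x ∈ S.X, S.ret x u - p * S.risk x u = S.Vp p x

/-- `u` is optimal for the constrained problem `sup_{u safe} E_{x ∼ μ} [G(x, u)]`. -/
def IsConstrainedOptimal (μ : Measure (EuclideanSpace ℝ (Fin n)))
    (u : EuclideanSpace ℝ (Fin n) → EuclideanSpace ℝ (Fin m)) : Prop :=
  u ∈ S.safeControllers ∧
    ∀ w ∈ S.safeControllers, ∫ x, S.ret x w ∂μ ≤ ∫ x, S.ret x u ∂μ

/-- `V_p` is a safe value function: all of its optimal controllers are safe and optimal for the
constrained problem. -/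
def IsSafeValueFunction (μ : Measure (EuclideanSpace ℝ (Fin n))) (p : ℝ) : Prop :=
  ∀ u, S.IsOptimal p u → u ∈ S.safeControllers ∧ S.IsConstrainedOptimal μ u

/-- `sup V_p` over the unviability kernel (`⊥` if that is empty). -/
def alphaInf (p : ℝ) : EReal := ⨆ x ∈ S.XU, ((S.Vp p x : ℝ) : EReal)

/-- `inf V` over the viability kernel. -/
def alphaSup : EReal := ⨅ x ∈ S.XV, ((S.V x : ℝ) : EReal)

/-- The zeroth-order condition in continuous time. -/
def ZerothOrderCondition (p : ℝ) : Prop := S.alphaInf p < S.alphaSup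

end ControlProblem

/-- `h` is continuously differentiable on the set `D`, with gradient field `g`. (If `D` is thin,
`h` may have several such fields.) -/
def IsC1OnWithGradient {n : ℕ} (D : Set (EuclideanSpace ℝ (Fin n)))
    (h : EuclideanSpace ℝ (Fin n) → ℝ)
    (g : EuclideanSpace ℝ (Fin n) → EuclideanSpace ℝ (Fin n)) : Prop :=
  ContinuousOn g D ∧ ∀ x ∈ D, HasGradientWithinAt h (g x) D x

/-- Extended class `K∞` functions. -/
def IsExtendedClassKInf (κ : ℝ → ℝ) : Prop :=
  Continuous κ ∧ StrictMono κ ∧ κ 0 = 0 ∧ Tendsto κ atTop atTop ∧ Tendsto κ atBot atBot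

/-- `h : D → ℝ` is a control barrier function of the closed set `C ⊆ D` for the dynamics
`ẋ = f(x, u)`, `u ∈ U`: `h` is continuously differentiable on `D`, `C` is its `0`-superlevel set,
and for some extended class `K∞` function `κ` one has
`sup_{u ∈ U} ∇h(x) ⬝ f(x, u) ≥ - κ(h(x))` for all `x ∈ D`. -/
structure IsControlBarrierFunction {n m : ℕ}
    (f : EuclideanSpace ℝ (Fin n) → EuclideanSpace ℝ (Fin m) → EuclideanSpace ℝ (Fin n))
    (U : Set (EuclideanSpace ℝ (Fin m))) (C D : Set (EuclideanSpace ℝ (Fin n)))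
    (h : EuclideanSpace ℝ (Fin n) → ℝ) : Prop where
  isClosed : IsClosed C
  subset : C ⊆ D
  contDiff : ∃ g, IsC1OnWithGradient D h g
  superlevel : C = {x | x ∈ D ∧ 0 ≤ h x}
  barrier : ∀ g, IsC1OnWithGradient D h g → ∃ κ : ℝ → ℝ, IsExtendedClassKInf κ ∧
    ∀ x ∈ D, ((-κ (h x) : ℝ) : EReal) ≤ ⨆ a ∈ U, ((inner ℝ (g x) (f x a) : ℝ) : EReal)

end

open scoped NNReal

/-!
Started at a viable state `x`, a safe trajectory stays in `X_V`, because its time shifts are safe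
trajectories too. If `h ≥ 0` on `X_V` and `h x = 0`, then `h` is minimal at the start of such a
trajectory, so it does not decrease along the initial velocity and the barrier supremum
`F x = sup_a ∇h(x) ⬝ f(x, a)` is nonnegative. As `F` is lower semicontinuous and `X_V` is compact,
for every `ε > 0` some slope `c` gives `-F ≤ ε + c h` on `X_V`: where `-F ≥ ε`, `h` is bounded away
from `0`. The infimum of these affine bounds over `ε` is concave, hence continuous, and yields a
single rate `κ`. Finally, safe controllers carry no risk, so `V ≤ V_p` on `X_V` and `V_p - α ≥ 0`
there.
-/

section ClassKInf

theorem isExtendedClassKInf_id_add_comp_max {ψ : ℝ → ℝ} (hcont : ContinuousOn ψ (Ici 0))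
    (hmono : MonotoneOn ψ (Ici 0)) (hzero : ψ 0 = 0) :
    IsExtendedClassKInf fun s => s + ψ (max s 0) := by
  have hmono' : Monotone fun s => ψ (max s 0) := fun s t hst =>
    hmono (le_max_right s 0) (le_max_right t 0) (max_le_max_right 0 hst)
  have hneg : ∀ s ≤ 0, ψ (max s 0) = 0 := fun s hs => by rw [max_eq_right hs, hzero]
  refine ⟨?_, strictMono_id.add_monotone hmono', by simp [hzero], ?_, ?_⟩
  · exact continuous_id.add
      (hcont.comp_continuous (by fun_prop) fun s => mem_Ici.2 (le_max_right s 0))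
  · refine tendsto_atTop_mono' _ ?_ tendsto_id
    filter_upwards [eventually_ge_atTop 0] with s hs
    exact le_add_of_nonneg_right ((hneg 0 le_rfl).ge.trans (hmono' hs))
  · refine tendsto_id.congr' ?_
    filter_upwards [eventually_le_atBot 0] with s hs
    simp [hneg s hs]

/-- The lower envelope on `[0, ∞)` of the affine functions `s ↦ ε + c ε * s`, one for each
intercept `ε > 0`; it combines the bounds `ε + c ε * s` into a single rate. For `s < 0` the family
may be unbounded below, and the value is then the junk value `0` of `⨅`. -/
noncomputable def affineEnvelope (c : Ioi (0 : ℝ) → ℝ≥0) (s : ℝ) : ℝ :=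
  ⨅ ε : Ioi (0 : ℝ), ((ε : ℝ) + c ε * s)

variable (c : Ioi (0 : ℝ) → ℝ≥0) {s v : ℝ}

theorem affineEnvelope_le (hs : 0 ≤ s) (ε : Ioi (0 : ℝ)) : affineEnvelope c s ≤ ε + c ε * s := by
  refine ciInf_le ⟨0, forall_mem_range.2 fun δ => ?_⟩ ε
  exact add_nonneg (le_of_lt δ.2) (mul_nonneg (c δ).2 hs)

theorem le_affineEnvelope (hv : ∀ ε : Ioi (0 : ℝ), v ≤ ε + c ε * s) : v ≤ affineEnvelope c s :=
  le_ciInf hv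

theorem affineEnvelope_nonneg (hs : 0 ≤ s) : 0 ≤ affineEnvelope c s :=
  le_affineEnvelope c fun ε => add_nonneg (le_of_lt ε.2) (mul_nonneg (c ε).2 hs)

theorem affineEnvelope_zero : affineEnvelope c 0 = 0 := by
  refine le_antisymm (le_of_forall_pos_le_add fun ε hε => ?_) (affineEnvelope_nonneg c le_rfl)
  simpa using affineEnvelope_le c le_rfl ⟨ε, hε⟩

theorem monotoneOn_affineEnvelope : MonotoneOn (affineEnvelope c) (Ici 0) := by
  refine fun s hs t _ hst => le_affineEnvelope c fun ε => (affineEnvelope_le c hs ε).trans ?_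
  gcongr

theorem concaveOn_affineEnvelope : ConcaveOn ℝ (Ici 0) (affineEnvelope c) := by
  refine ⟨convex_Ici 0, fun s hs t ht a b ha hb hab => le_affineEnvelope c fun ε => ?_⟩
  calc a * affineEnvelope c s + b * affineEnvelope c t
      ≤ a * (ε + c ε * s) + b * (ε + c ε * t) := by
        gcongr
        exacts [affineEnvelope_le c hs ε, affineEnvelope_le c ht ε]
    _ = (a + b) * ε + c ε * (a * s + b * t) := by ring
    _ = ε + c ε * (a * s + b * t) := by rw [hab, one_mul]

theorem continuousOn_affineEnvelope : ContinuousOn (affineEnvelope c) (Ici 0) := by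
  refine (concaveOn_affineEnvelope c).continuousOn_Ici ?_
  rw [ContinuousWithinAt, affineEnvelope_zero, tendsto_order]
  refine ⟨fun a ha => ?_, fun a ha => ?_⟩
  · filter_upwards [self_mem_nhdsWithin] with t ht using ha.trans_le (affineEnvelope_nonneg c ht)
  · let ε : Ioi (0 : ℝ) := ⟨a / 2, half_pos ha⟩
    have hlim : Tendsto (fun t : ℝ => (ε : ℝ) + c ε * t) (𝓝[Ici 0] 0) (𝓝 (a / 2)) := by
      have hcont : Continuous fun t : ℝ => (ε : ℝ) + c ε * t := by fun_prop
      simpa [ε] using (hcont.tendsto 0).mono_left nhdsWithin_le_nhds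
    filter_upwards [self_mem_nhdsWithin, hlim.eventually_lt_const (half_lt_self ha)]
      with t ht hlt using (affineEnvelope_le c ht ε).trans_lt hlt

theorem exists_isExtendedClassKInf_of_affine_bounds :
    ∃ κ : ℝ → ℝ, IsExtendedClassKInf κ ∧
      ∀ s v : ℝ, 0 ≤ s → (∀ ε : Ioi (0 : ℝ), v ≤ ε + c ε * s) → v ≤ κ s := by
  refine ⟨_, isExtendedClassKInf_id_add_comp_max (continuousOn_affineEnvelope c)
    (monotoneOn_affineEnvelope c) (affineEnvelope_zero c), fun s v hs hv => ?_⟩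
  rw [max_eq_left hs]
  exact (le_affineEnvelope c hv).trans (le_add_of_nonneg_left hs)

end ClassKInf

section Compact

variable {X : Type*} [TopologicalSpace X] {K : Set X}

theorem exists_gt_forall_le_of_lowerSemicontinuousOn {β : Type*} [LinearOrder β] {φ : X → β}
    {a : β} (ha : ¬IsMax a) (hK : IsCompact K) (hφ : LowerSemicontinuousOn φ K)
    (hlt : ∀ x ∈ K, a < φ x) : ∃ b, a < b ∧ ∀ x ∈ K, b ≤ φ x := by
  rcases K.eq_empty_or_nonempty with rfl | hne
  · obtain ⟨b, hb⟩ := not_isMax_iff.1 ha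
    exact ⟨b, hb, fun _ hx => hx.elim⟩
  · obtain ⟨x₀, hx₀, hmin⟩ := hφ.exists_isMinOn hne hK
    exact ⟨φ x₀, hlt x₀ hx₀, hmin⟩

theorem exists_neg_coe_le_of_lowerSemicontinuousOn {F : X → EReal} (hK : IsCompact K)
    (hF : LowerSemicontinuousOn F K) (hbot : ∀ x ∈ K, ⊥ < F x) :
    ∃ M : ℝ≥0, ∀ x ∈ K, ((-M : ℝ) : EReal) ≤ F x := by
  obtain ⟨b, hb, hle⟩ := exists_gt_forall_le_of_lowerSemicontinuousOn not_isMax_bot hK hF hbot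
  obtain ⟨B, -, hB⟩ := EReal.lt_iff_exists_real_btwn.1 hb
  refine ⟨(-B).toNNReal, fun x hx => le_trans ?_ (hB.le.trans (hle x hx))⟩
  exact EReal.coe_le_coe_iff.2 (neg_le.1 (Real.le_coe_toNNReal (-B)))

variable {h : X → ℝ} {F : X → EReal}

theorem exists_neg_affine_le (hK : IsCompact K) (hh : LowerSemicontinuousOn h K)
    (h_nonneg : ∀ x ∈ K, 0 ≤ h x) (hF : LowerSemicontinuousOn F K) (hbot : ∀ x ∈ K, ⊥ < F x)
    (hzero : ∀ x ∈ K, h x = 0 → 0 ≤ F x) {ε : ℝ} (hε : 0 < ε) :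
    ∃ c : ℝ≥0, ∀ x ∈ K, ((-(ε + c * h x) : ℝ) : EReal) ≤ F x := by
  obtain ⟨M, hM⟩ := exists_neg_coe_le_of_lowerSemicontinuousOn hK hF hbot
  obtain ⟨δ, hδ, hle⟩ : ∃ δ, 0 < δ ∧ ∀ x ∈ K ∩ F ⁻¹' Iic ((-ε : ℝ) : EReal), δ ≤ h x := by
    refine exists_gt_forall_le_of_lowerSemicontinuousOn (not_isMax 0)
      (hF.isCompact_inter_preimage_Iic hK _) (hh.mono inter_subset_left) fun x hx => ?_
    refine (h_nonneg x hx.1).lt_of_ne fun h0 => (hzero x hx.1 h0.symm).not_gt ?_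
    exact lt_of_le_of_lt hx.2 (EReal.coe_lt_coe_iff.2 (neg_neg_of_pos hε))
  refine ⟨M / δ.toNNReal, fun x hx => ?_⟩
  rw [NNReal.coe_div, Real.coe_toNNReal δ hδ.le]
  have h0 := h_nonneg x hx
  rcases le_or_gt (F x) ((-ε : ℝ) : EReal) with hx' | hx'
  · have hMh : (M : ℝ) ≤ M / δ * h x := by
      rw [div_mul_eq_mul_div, le_div_iff₀ hδ]
      exact mul_le_mul_of_nonneg_left (hle x ⟨hx, hx'⟩) M.2
    exact le_trans (EReal.coe_le_coe_iff.2 (by linarith)) (hM x hx)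
  · have hch : 0 ≤ M / δ * h x := by positivity
    exact le_trans (EReal.coe_le_coe_iff.2 (by linarith)) hx'.le

theorem exists_isExtendedClassKInf_neg_le (hK : IsCompact K) (hh : LowerSemicontinuousOn h K)
    (h_nonneg : ∀ x ∈ K, 0 ≤ h x) (hF : LowerSemicontinuousOn F K) (hbot : ∀ x ∈ K, ⊥ < F x)
    (hzero : ∀ x ∈ K, h x = 0 → 0 ≤ F x) :
    ∃ κ : ℝ → ℝ, IsExtendedClassKInf κ ∧ ∀ x ∈ K, ((-κ (h x) : ℝ) : EReal) ≤ F x := by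
  choose c hc using fun ε : Ioi (0 : ℝ) =>
    exists_neg_affine_le hK hh h_nonneg hF hbot hzero ε.2
  obtain ⟨κ, hκ, hdom⟩ := exists_isExtendedClassKInf_of_affine_bounds c
  refine ⟨κ, hκ, fun x hx => EReal.le_of_forall_lt_iff_le.1 fun b hb => ?_⟩
  refine EReal.coe_le_coe_iff.2 (neg_le.1 (hdom _ _ (h_nonneg x hx) fun ε => neg_le.1 ?_))
  exact EReal.coe_le_coe_iff.1 ((hc ε x hx).trans hb.le)

end Compact

section Gradient

theorem lowerSemicontinuousOn_iSup_inner {E A : Type*} [NormedAddCommGroup E]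
    [InnerProductSpace ℝ E] {K : Set E} {U : Set A} {f : E → A → E} {g : E → E}
    (hf : ∀ a ∈ U, ContinuousOn (fun x => f x a) K) (hg : ContinuousOn g K) :
    LowerSemicontinuousOn (fun x => ⨆ a ∈ U, ((inner ℝ (g x) (f x a) : ℝ) : EReal)) K :=
  lowerSemicontinuousOn_biSup fun a ha =>
    (continuous_coe_real_ereal.comp_continuousOn (hg.inner (hf a ha))).lowerSemicontinuousOn

theorem inner_gradient_velocity_nonneg {E : Type*} [NormedAddCommGroup E] [InnerProductSpace ℝ E]
    [CompleteSpace E] {K : Set E} {h : E → ℝ} {y : ℝ → E} {v w : E} {t : ℝ}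
    (hv : HasGradientWithinAt h v K (y t)) (hmin : IsLocalMinOn h K (y t))
    (hy : HasDerivWithinAt y w (Ici t) t) (hK : MapsTo y (Ici t) K) : 0 ≤ inner ℝ v w := by
  have hmin' : IsLocalMinOn (h ∘ y) (Ici t) t :=
    hmin.comp_tendsto (hy.continuousWithinAt.tendsto_nhdsWithin hK)
  have hderiv := hv.hasFDerivWithinAt.comp_hasDerivWithinAt t hy hK
  have hone : (1 : ℝ) ∈ posTangentConeAt (Ici t) t :=
    mem_posTangentConeAt_of_segment_subset <| by
      rw [segment_eq_Icc (by simp)]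
      exact Icc_subset_Ici_self
  simpa using hmin'.hasFDerivWithinAt_nonneg hderiv.hasFDerivWithinAt hone

variable {n : ℕ} {D : Set (EuclideanSpace ℝ (Fin n))} {h : EuclideanSpace ℝ (Fin n) → ℝ}
  {g : EuclideanSpace ℝ (Fin n) → EuclideanSpace ℝ (Fin n)}

theorem IsC1OnWithGradient.continuousOn (H : IsC1OnWithGradient D h g) : ContinuousOn h D :=
  fun x hx => (H.2 x hx).hasFDerivWithinAt.continuousWithinAt

theorem IsC1OnWithGradient.sub_const (H : IsC1OnWithGradient D h g) (c : ℝ) :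
    IsC1OnWithGradient D (fun x => h x - c) g :=
  ⟨H.1, fun x hx => (H.2 x hx).hasFDerivWithinAt.sub_const c⟩

end Gradient

namespace ControlProblem

variable {n m : ℕ} {S : ControlProblem n m}
  {u : EuclideanSpace ℝ (Fin n) → EuclideanSpace ℝ (Fin m)}
  {x : EuclideanSpace ℝ (Fin n)} {y : ℝ → EuclideanSpace ℝ (Fin n)}

theorem isTrajectory_flow (hu : u ∈ S.controllers) (hx : x ∈ S.X) :
    S.IsTrajectory u x (S.flow u x) := by
  have hex : ∃ y, S.IsTrajectory u x y := (hu.2.2 x hx).imp fun _ hy => hy.1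
  rw [flow, dif_pos hex]
  exact hex.choose_spec

theorem IsTrajectory.eqOn_flow (hu : u ∈ S.controllers) (hx : x ∈ S.X)
    (hy : S.IsTrajectory u x y) : EqOn y (S.flow u x) (Ici 0) := by
  obtain ⟨z, -, hz⟩ := hu.2.2 x hx
  exact (hz y hy).trans (hz _ (isTrajectory_flow hu hx)).symm

theorem IsTrajectory.comp_const_add (hy : S.IsTrajectory u x y) {s : ℝ} (hs : 0 ≤ s) :
    S.IsTrajectory u (y s) fun t => y (s + t) := by
  refine ⟨by simp, hy.2.1.comp (by fun_prop) fun t ht => add_nonneg hs ht, fun t ht => ?_⟩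
  obtain ⟨hX, hderiv⟩ := hy.2.2 (s + t) (add_nonneg hs ht)
  have hmaps : MapsTo (fun t => s + t) (Ici t) (Ici (s + t)) := fun r hr =>
    add_le_add_right (mem_Ici.1 hr) s
  refine ⟨hX, ?_⟩
  simpa [Function.comp_def] using
    hderiv.scomp t ((hasDerivWithinAt_id t (Ici t)).const_add s) hmaps

theorem SafeFor.mapsTo_flow_XV (hu : u ∈ S.controllers) (hx : x ∈ S.X) (hsafe : S.SafeFor u x) :
    MapsTo (S.flow u x) (Ici 0) S.XV := by
  intro s hs
  have hy := isTrajectory_flow hu hx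
  have hX := (hy.2.2 s hs).1
  refine ⟨hX, u, hu, fun t ht => ?_⟩
  rw [← (hy.comp_const_add hs).eqOn_flow hu hX ht]
  exact hsafe _ (add_nonneg hs ht)

theorem U_nonempty_of_mem_XV (hx : x ∈ S.XV) : S.U.Nonempty := by
  obtain ⟨hX, u, hu, -⟩ := hx
  exact ⟨u x, hu.1 hX⟩

theorem exists_inner_gradient_nonneg (hx : x ∈ S.XV) {h : EuclideanSpace ℝ (Fin n) → ℝ}
    {v : EuclideanSpace ℝ (Fin n)} (hv : HasGradientWithinAt h v S.XV x)
    (hmin : IsLocalMinOn h S.XV x) : ∃ a ∈ S.U, 0 ≤ inner ℝ v (S.f x a) := by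
  obtain ⟨hX, u, hu, hsafe⟩ := hx
  obtain ⟨hstart, -, hmove⟩ := isTrajectory_flow hu hX
  refine ⟨u x, hu.1 hX, ?_⟩
  rw [← hstart] at hv hmin
  simpa only [hstart] using
    inner_gradient_velocity_nonneg hv hmin (hmove 0 le_rfl).2 (hsafe.mapsTo_flow_XV hu hX)

theorem isControlBarrierFunction_of_nonneg
    (hf : ∀ a ∈ S.U, ContinuousOn (fun x => S.f x a) S.XV) (hcompact : IsCompact S.XV)
    {h : EuclideanSpace ℝ (Fin n) → ℝ} (hC1 : ∃ g, IsC1OnWithGradient S.XV h g)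
    (h_nonneg : ∀ x ∈ S.XV, 0 ≤ h x) : IsControlBarrierFunction S.f S.U S.XV S.XV h where
  isClosed := hcompact.isClosed
  subset := subset_rfl
  contDiff := hC1
  superlevel := ext fun x => ⟨fun hx => ⟨hx, h_nonneg x hx⟩, And.left⟩
  barrier g hg := by
    refine exists_isExtendedClassKInf_neg_le hcompact hg.continuousOn.lowerSemicontinuousOn
      h_nonneg (lowerSemicontinuousOn_iSup_inner hf hg.1) (fun x hx => ?_) fun x hx h0 => ?_
    · obtain ⟨a, ha⟩ := U_nonempty_of_mem_XV hx
      exact (EReal.bot_lt_coe _).trans_le (le_iSup₂_of_le a ha le_rfl)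
    · have hmin : IsMinOn h S.XV x := fun z hz => h0.trans_le (h_nonneg z hz)
      obtain ⟨a, ha, hinner⟩ := exists_inner_gradient_nonneg hx (hg.2 x hx) hmin.localize
      exact le_iSup₂_of_le a ha (EReal.coe_nonneg.2 hinner)

theorem abs_ret_le {M : ℝ} (hM : ∀ x ∈ S.X, ∀ a ∈ S.U, |S.r x a| ≤ M)
    (hu : u ∈ S.controllers) (hx : x ∈ S.X) : |S.ret x u| ≤ S.τ * M := by
  have hexp : ∀ t : ℝ, Real.exp (-t / S.τ) = Real.exp (-S.τ⁻¹ * t) := fun t => by ring_nf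
  have hrate : -S.τ⁻¹ < 0 := by simpa using S.τ_pos
  have hint : IntegrableOn (fun t : ℝ => Real.exp (-t / S.τ) * M) (Ioi 0) := by
    simp only [hexp]
    exact (integrableOn_exp_mul_Ioi hrate 0).mul_const M
  have hvalue : ∫ t in Ioi (0 : ℝ), Real.exp (-t / S.τ) * M = S.τ * M := by
    simp only [hexp, integral_mul_const, integral_exp_mul_Ioi hrate]
    simp
  rw [← hvalue, ← Real.norm_eq_abs, ret]
  refine norm_integral_le_of_norm_le hint ?_
  filter_upwards [self_mem_ae_restrict measurableSet_Ioi] with t ht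
  have hX := ((isTrajectory_flow hu hx).2.2 t (le_of_lt ht)).1
  rw [norm_mul, Real.norm_eq_abs, Real.norm_eq_abs, Real.abs_exp]
  exact mul_le_mul_of_nonneg_left (hM _ hX _ (hu.1 hX)) (Real.exp_pos _).le

theorem risk_mem_Icc : S.risk x u ∈ Icc (0 : ℝ) 1 := by
  unfold risk
  split_ifs
  · exact ⟨le_rfl, zero_le_one⟩
  · have htime : 0 ≤ S.failureTime x u := Real.sInf_nonneg fun t ht => ht.1
    refine ⟨(Real.exp_pos _).le, Real.exp_le_one_iff.2 ?_⟩
    exact div_nonpos_of_nonpos_of_nonneg (neg_nonpos.2 htime) S.τ_pos.le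

theorem bddAbove_penalized_return (p : ℝ) (hx : x ∈ S.X) :
    BddAbove ((fun u => S.ret x u - p * S.risk x u) '' S.controllers) := by
  obtain ⟨M, hM⟩ := S.r_bounded
  refine ⟨S.τ * M + |p|, forall_mem_image.2 fun u hu => ?_⟩
  obtain ⟨hrisk₀, hrisk₁⟩ := S.risk_mem_Icc (x := x) (u := u)
  have hret := (le_abs_self _).trans (abs_ret_le hM hu hx)
  have hpenalty : -p * S.risk x u ≤ |p| :=
    (mul_le_mul_of_nonneg_right (neg_le_abs p) hrisk₀).trans
      (mul_le_of_le_one_right (abs_nonneg p) hrisk₁)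
  linarith

theorem V_le_Vp (p : ℝ) (hne : S.safeControllers.Nonempty) (hx : x ∈ S.XV) :
    S.V x ≤ S.Vp p x := by
  refine csSup_le (hne.image _) (forall_mem_image.2 fun w hw => ?_)
  refine le_csSup (bddAbove_penalized_return p hx.1) ⟨w, hw.1, ?_⟩
  simp [risk, hw.2 x hx]

theorem le_Vp_of_le_alphaSup (p : ℝ) (hne : S.safeControllers.Nonempty) {α : ℝ}
    (hα : (α : EReal) ≤ S.alphaSup) (hx : x ∈ S.XV) : α ≤ S.Vp p x :=
  (EReal.coe_le_coe_iff.1 (hα.trans (iInf₂_le x hx))).trans (V_le_Vp p hne hx)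

end ControlProblem

theorem proposition4_general {n m : ℕ} (S : ControlProblem n m) (p : ℝ)
    (hf : ∀ a ∈ S.U, ContinuousOn (fun x => S.f x a) S.XV)
    (hne : S.safeControllers.Nonempty) (hcompact : IsCompact S.XV)
    (hC1 : ∃ g, IsC1OnWithGradient S.XV (S.Vp p) g) (α : ℝ) (hα : (α : EReal) ≤ S.alphaSup) :
    IsControlBarrierFunction S.f S.U S.XV S.XV (fun x => S.Vp p x - α) :=
  S.isControlBarrierFunction_of_nonneg hf hcompact (hC1.imp fun _ hg => hg.sub_const α)
    fun _ hx => sub_nonneg.2 (S.le_Vp_of_le_alphaSup p hne hα hx)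

theorem proposition4 {n m : ℕ} (S : ControlProblem n m)
    (μ : Measure (EuclideanSpace ℝ (Fin n))) [IsProbabilityMeasure μ]
    (hμ : μ.support ⊆ S.XV)
    (p : ℝ) (hp : 0 ≤ p)
    (habs : S.FailureAbsorbing)
    (hf : ContinuousOn (fun q : EuclideanSpace ℝ (Fin n) × EuclideanSpace ℝ (Fin m) =>
      S.f q.1 q.2) (S.XV ×ˢ S.U))
    (hatt : ∃ u, S.IsOptimal p u)
    (hsafe : S.IsSafeValueFunction μ p)
    (hzero : S.ZerothOrderCondition p)
    (hcompact : IsCompact S.XV)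
    (g : EuclideanSpace ℝ (Fin n) → EuclideanSpace ℝ (Fin n))
    (hC1 : IsC1OnWithGradient S.XV (S.Vp p) g)
    (hgrad : ∀ x ∈ S.XV ∩ closure S.XU, g x ≠ 0)
    (α : ℝ) (hα : S.alphaInf p < (α : EReal)) (hα' : (α : EReal) ≤ S.alphaSup) :
    IsControlBarrierFunction S.f S.U S.XV S.XV (fun x => S.Vp p x - α) := by
  exact proposition4_general S p (fun _ ha => hf.uncurry_right _ ha)
    (hatt.imp fun u hu => (hsafe u hu).1) hcompact ⟨g, hC1⟩ α hα'
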